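/- All cardinals below are attached to a topological space $(X,\mathcal T)$ as follows. The space is *crowded* if it has no isolated points. A *cellular family* is a family of nonempty pairwise disjoint open sets, and the *Souslin number* $S(X,\mathcal T)$ is the least cardinal $\lambda$ such that no cellular family has cardinality exactly $\lambda$. The *dispersion character* $\Delta(X,\mathcal T)$ is the least cardinality of a nonempty open subset of $X$. For a cardinal $\lambda$, the space is *$\lambda$-resolvable* if there is a family of $\lambda$-many pairwise disjoint dense subsets of $X$, and it is *maximally resolvable* if it is $\Delta(X,\mathcal T)$-resolvable. *Tychonoff* means completely regular and Hausdorff. **Theorem.** Let $(X,\mathcal T)$ be a crowded, $\omega$-resolvable Tychonoff space with $S(X,\mathcal T)\le |X|=\Delta(X,\mathcal T)=\kappa$. Then there is a Tychonoff topology $\mathcal U\supseteq\mathcal T$ on $X$ such that (a) $S(X,\mathcal U)=S(X,\mathcal T)$ and $\Delta(X,\mathcal U)=\Delta(X,\mathcal T)$; (b) $(X,\mathcal U)$ is $\omega$-resolvable; (c) $(X,\mathcal U)$ is not maximally resolvable; and (d) if $(X,\mathcal T)$ is maximally resolvable, then $(X,\mathcal U)$ is not $S(X,\mathcal T)$-resolvable.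 -/

import Mathlib

open Cardinal Topology

universe u

/-- `T` is crowded: no point is isolated. -/
def IsCrowded {X : Type u} (T : TopologicalSpace X) : Prop :=
  ∀ x : X, ¬ IsOpen[T] {x}

/-- A cellular family: a family of nonempty, pairwise disjoint open sets. -/
def IsCellular {X : Type u} (T : TopologicalSpace X) (𝒞 : Set (Set X)) : Prop :=
  (∀ V ∈ 𝒞, IsOpen[T] V ∧ V.Nonempty) ∧ 𝒞.PairwiseDisjoint id

/-- The Souslin number `S(X, T)`: the least cardinal that is not the cardinality of
a cellular family. -/
noncomputable def souslinNumber {X : Type u} (T : TopologicalSpace X) : Cardinal.{u} :=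
  sInf {c : Cardinal.{u} | ¬ ∃ 𝒞 : Set (Set X), IsCellular T 𝒞 ∧ #𝒞 = c}

/-- The dispersion character `Δ(X, T)`: the least cardinality of a nonempty open set. -/
noncomputable def dispersionCharacter {X : Type u} (T : TopologicalSpace X) : Cardinal.{u} :=
  sInf {c : Cardinal.{u} | ∃ V : Set X, IsOpen[T] V ∧ V.Nonempty ∧ #V = c}

/-- `T` is `c`-resolvable: there is a family of `c`-many pairwise disjoint dense sets. -/
def IsResolvable {X : Type u} (T : TopologicalSpace X) (c : Cardinal.{u}) : Prop :=
  ∃ 𝒟 : Set (Set X), #𝒟 = c ∧ (∀ D ∈ 𝒟, @Dense X T D) ∧ 𝒟.PairwiseDisjoint id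

/-- `T` is maximally resolvable: it is `Δ(X, T)`-resolvable. -/
def IsMaximallyResolvable {X : Type u} (T : TopologicalSpace X) : Prop :=
  IsResolvable T (dispersionCharacter T)

/-! If `T` is not maximally resolvable, `T` itself serves. Otherwise split `κ` disjoint dense sets,
in Hausdorff's manner, into disjoint `D n` and an independent family `B E` indexed by all `E ⊆ X`,
with every `D n` meeting every cell in `κ` points. By Zorn, replace `B E` by `B E \ E` for as many
`E` as this largeness permits, and declare the resulting sets `C E` clopen.

A set `E` dense in the new topology was not trimmed, as it would miss `C E`. By maximality trimming
it destroys largeness, so `E` contains all but fewer than `κ` points of some `D n ∩ O` with `O` open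
and nonempty. Given `S(X)` disjoint dense sets, fix `n` for `S(X)` of them: their `O`'s are pairwise
disjoint, which is impossible. This gives (d), and (c) since `S(X) ≤ κ`.

Fixing `n` and the `Δ`-system argument for `S(U) = S(T)` both use that `S(X)` is regular
(Erdős–Tarski). -/

/-! ### Infinite combinatorics -/

theorem exists_maximal_pairwise {α : Type u} {r : α → α → Prop} (hr : ∀ a b, r a b → r b a)
    (S : Set α) :
    ∃ t ⊆ S, t.Pairwise r ∧ ∀ a ∈ S, (∀ b ∈ t, r a b) → a ∈ t := by
  obtain ⟨t, ht, hmax⟩ := zorn_subset {t : Set α | t ⊆ S ∧ t.Pairwise r} (by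
    intro c hc hchain
    refine ⟨⋃₀ c, ⟨Set.sUnion_subset fun s hs => (hc hs).1, ?_⟩, fun s hs =>
      Set.subset_sUnion_of_mem hs⟩
    exact (Set.pairwise_sUnion hchain.directedOn).2 fun s hs => (hc hs).2)
  refine ⟨t, ht.1, ht.2, fun a ha hab => ?_⟩
  refine hmax (y := insert a t) ⟨Set.insert_subset ha ht.1, ?_⟩ (Set.subset_insert a t)
    (Set.mem_insert a t)
  exact ht.2.insert fun b hb _ => ⟨hab b hb, hr _ _ (hab b hb)⟩

/-- Recursion along a well-order of least type: fewer than `#ι` values are taken before each stage.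
-/
theorem exists_injective_choice {ι β : Type u} (G : ι → Set β) (hG : ∀ i, #ι ≤ #(G i)) :
    ∃ h : ι → β, Function.Injective h ∧ ∀ i, h i ∈ G i := by
  obtain ⟨r, hr, hord⟩ := exists_ord_eq ι
  have key : ∀ (i : ι) (f : {j // r j i} → β), ∃ b ∈ G i, b ∉ Set.range f := by
    intro i f
    by_contra! hcon
    have h1 : #(G i) ≤ #(Set.range f) := mk_le_mk_of_subset hcon
    have h2 : #{j // r j i} < #ι := by
      have := Ordinal.typein_lt_type r i
      rw [← hord, lt_ord] at this
      simpa using this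
    exact absurd ((hG i).trans (h1.trans mk_range_le)) (not_le.2 h2)
  choose F hF hF' using key
  have wf : WellFounded r := hr.wf
  let h : ι → β := wf.fix fun i f => F i fun j => f j.1 j.2
  have heq : ∀ i, h i = F i fun j => h j.1 := fun i => wf.fix_eq _ i
  have hne : ∀ i j, r j i → h j ≠ h i := by
    intro i j hji he
    exact hF' i (fun j => h j.1) ⟨⟨j, hji⟩, by rw [← heq]; exact he⟩
  refine ⟨h, fun i j hij => ?_, fun i => by rw [heq]; exact hF _ _⟩
  rcases trichotomous_of r i j with h1 | h1 | h1
  · exact absurd hij (hne _ _ h1)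
  · exact h1
  · exact absurd hij.symm (hne _ _ h1)

/-- The counting half of the `Δ`-system argument: in a family of uncountable regular size, if any
two members are either related by `r` or separated by a common coordinate of their finite supports,
then a subfamily of the same size is pairwise related. -/
theorem exists_pairwise_subfamily_of_card {c : Cardinal.{u}} (hc : c.IsRegular) {J : Type u}
    (n : ℕ) :
    ∀ {ι : Type u} (r : ι → ι → Prop) (F : ι → Finset J) (σ : ι → Set J), c ≤ #ι →
      (∀ i, (F i).card = n) →
      (∀ i j, i ≠ j → r i j ∨ ∃ e ∈ F i, e ∈ F j ∧ ¬(e ∈ σ i ↔ e ∈ σ j)) →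
      ∃ t : Set ι, c ≤ #t ∧ t.Pairwise r := by
  classical
  induction n with
  | zero =>
    intro ι r F σ hι hF hr
    refine ⟨Set.univ, by simpa using hι, fun i _ j _ hij => ?_⟩
    rcases hr i j hij with h | ⟨e, he, -⟩
    · exact h
    · simp [Finset.card_eq_zero.1 (hF i)] at he
  | succ n ih =>
    intro ι r F σ hι hF hr
    -- A coordinate shared by `c` supports is given a constant sign and erased. If there is none, a
    -- maximal subfamily with disjoint supports has size at least `c` by regularity, and disjoint
    -- supports rule out separation.
    by_cases h : ∃ e, c ≤ #{i | e ∈ F i}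
    · obtain ⟨e, he⟩ := h
      obtain ⟨a, s, hs, hcs, hsa⟩ := infinite_pigeonhole_set
        (s := {i | e ∈ F i}) (fun i => ULift.up.{u} (decide (e ∈ σ i.1))) c he hc.aleph0_le
        (by rw [hc.cof_ord]; exact (mk_lt_aleph0 (α := ULift.{u} Bool)).trans_le hc.aleph0_le)
      obtain ⟨t, ht, htr⟩ := ih (ι := s) (fun i j => r i j) (fun i => (F i).erase e)
        (fun i => σ i) hcs (fun i => by
          rw [Finset.card_erase_of_mem (hs i.2), hF]; rfl) (fun i j hij => by
          rcases hr i j (fun h => hij (Subtype.ext h)) with h | ⟨e', h1, h2, h3⟩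
          · exact Or.inl h
          · refine Or.inr ⟨e', ?_, ?_, h3⟩ <;>
            · refine Finset.mem_erase.2 ⟨?_, by assumption⟩
              rintro rfl
              have := (hsa i.2).trans (hsa j.2).symm
              simp only [ULift.up.injEq, decide_eq_decide] at this
              exact h3 this)
      refine ⟨Subtype.val '' t, by rwa [mk_image_eq Subtype.val_injective], ?_⟩
      rintro _ ⟨i, hi, rfl⟩ _ ⟨j, hj, rfl⟩ hij
      exact htr hi hj fun h => hij (congrArg _ h)
    · push Not at h
      obtain ⟨t, -, htd, htm⟩ := exists_maximal_pairwise
        (r := fun i j => Disjoint (F i) (F j)) (fun _ _ h => h.symm) Set.univ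
      refine ⟨t, ?_, fun i hi j hj hij => ?_⟩
      · by_contra! hlt
        have h1 : #(⋃ i ∈ t, ((F i : Finset J) : Set J)) < c :=
          (card_biUnion_lt_iff_forall_of_isRegular hc hlt).2 fun i _ =>
            (mk_lt_aleph0 (α := ((F i : Finset J) : Set J))).trans_le hc.aleph0_le
        have h2 : #(⋃ e ∈ (⋃ i ∈ t, ((F i : Finset J) : Set J)), {i | e ∈ F i}) < c :=
          (card_biUnion_lt_iff_forall_of_isRegular hc h1).2 fun e _ => h e
        refine absurd (hι.trans ?_) (not_le.2 h2)
        rw [← mk_univ]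
        refine mk_le_mk_of_subset fun i _ => ?_
        by_cases hi : i ∈ t
        · obtain ⟨e, he⟩ := Finset.card_pos.1 (by rw [hF i]; omega : 0 < (F i).card)
          simp only [Set.mem_iUnion]
          exact ⟨e, ⟨i, hi, he⟩, he⟩
        · have : ¬ ∀ b ∈ t, Disjoint (F i) (F b) := fun h => hi (htm i trivial h)
          push Not at this
          obtain ⟨b, hb, hib⟩ := this
          obtain ⟨e, he, he'⟩ := Finset.not_disjoint_iff.1 hib
          simp only [Set.mem_iUnion]
          exact ⟨e, ⟨b, hb, he'⟩, he⟩
      · rcases hr i j hij with h | ⟨e, h1, h2, -⟩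
        · exact h
        · exact absurd h2 (Finset.disjoint_left.1 (htd hi hj hij) h1)

theorem exists_pairwise_subfamily {c : Cardinal.{u}} (hc : c.IsRegular) (hc' : ℵ₀ < c)
    {J ι : Type u} (r : ι → ι → Prop) (F : ι → Finset J) (σ : ι → Set J) (hι : c ≤ #ι)
    (hr : ∀ i j, i ≠ j → r i j ∨ ∃ e ∈ F i, e ∈ F j ∧ ¬(e ∈ σ i ↔ e ∈ σ j)) :
    ∃ t : Set ι, c ≤ #t ∧ t.Pairwise r := by
  obtain ⟨n, hn⟩ := infinite_pigeonhole_card (fun i => ULift.up.{u} (F i).card) c hι hc.aleph0_le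
    (by rw [hc.cof_ord]; simpa using hc')
  obtain ⟨t, ht, htr⟩ := exists_pairwise_subfamily_of_card hc n.down
    (ι := ((fun i => ULift.up.{u} (F i).card) ⁻¹' {n} : Set ι)) (fun i j => r i j)
    (fun i => F i) (fun i => σ i) hn (fun i => congrArg ULift.down i.2)
    (fun i j hij => hr i j fun h => hij (Subtype.ext h))
  refine ⟨Subtype.val '' t, by rwa [mk_image_eq Subtype.val_injective], ?_⟩
  rintro _ ⟨i, hi, rfl⟩ _ ⟨j, hj, rfl⟩ hij
  exact htr hi hj fun h => hij (congrArg _ h)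

/-! ### Cellular families and the Erdős–Tarski theorem -/

/-- `V` contains `c` many nonempty pairwise disjoint open sets. -/
def CellularIn {X : Type u} (T : TopologicalSpace X) (V : Set X) (c : Cardinal.{u}) : Prop :=
  ∃ f : c.out → Set X, (∀ i, IsOpen[T] (f i) ∧ (f i).Nonempty ∧ f i ⊆ V) ∧
    Pairwise (Function.onFun Disjoint f)

section
variable {X : Type u} {T : TopologicalSpace X} {V : Set X}

theorem CellularIn.of_family {c : Cardinal.{u}} {ι : Type u} (f : ι → Set X)
    (hf : ∀ i, IsOpen[T] (f i) ∧ (f i).Nonempty ∧ f i ⊆ V)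
    (hd : Pairwise (Function.onFun Disjoint f)) (hc : c ≤ #ι) : CellularIn T V c := by
  rw [← mk_out c] at hc
  obtain ⟨e⟩ := hc
  exact ⟨fun i => f (e i), fun i => hf _, fun i j hij => hd (e.injective.ne hij)⟩

theorem CellularIn.mono {c d : Cardinal.{u}} (h : CellularIn T V c) (hd : d ≤ c) :
    CellularIn T V d := by
  obtain ⟨f, hf, hfd⟩ := h
  exact .of_family f hf hfd (by rwa [mk_out])

theorem CellularIn.sum {ι : Type u} {G : ι → Set X} (hG : Pairwise (Function.onFun Disjoint G))
    (hGV : ∀ i, G i ⊆ V) {c : ι → Cardinal.{u}} (h : ∀ i, CellularIn T (G i) (c i)) :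
    CellularIn T V (Cardinal.sum c) := by
  choose f hf hd using h
  refine .of_family (ι := Σ i, (c i).out) (fun p => f p.1 p.2)
    (fun p => ⟨(hf _ _).1, (hf _ _).2.1, (hf _ _).2.2.trans (hGV _)⟩) ?_ (by simp [mk_sigma])
  rintro ⟨i, a⟩ ⟨j, b⟩ hij
  by_cases h : i = j
  · subst h
    exact hd i fun hab => hij (Sigma.ext rfl (heq_of_eq hab))
  · exact (hG h).mono (hf i a).2.2 (hf j b).2.2

theorem cellularIn_univ_iff {c : Cardinal.{u}} :
    CellularIn T Set.univ c ↔ ∃ 𝒞 : Set (Set X), IsCellular T 𝒞 ∧ #𝒞 = c := by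
  constructor
  · rintro ⟨f, hf, hd⟩
    have hinj : Function.Injective f := by
      intro i j hij
      by_contra hne
      have := hd hne
      simp only [Function.onFun, hij, disjoint_self, Set.bot_eq_empty] at this
      exact (hf j).2.1.ne_empty this
    refine ⟨Set.range f, ⟨?_, ?_⟩, by rw [mk_range_eq f hinj, mk_out]⟩
    · rintro _ ⟨i, rfl⟩
      exact ⟨(hf i).1, (hf i).2.1⟩
    · rintro _ ⟨i, rfl⟩ _ ⟨j, rfl⟩ hij
      exact hd fun h => hij (congrArg f h)
  · rintro ⟨𝒞, ⟨h1, h2⟩, rfl⟩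
    exact .of_family (fun i : 𝒞 => i.1) (fun i => ⟨(h1 _ i.2).1, (h1 _ i.2).2, Set.subset_univ _⟩)
      (fun i j hij => h2 i.2 j.2 fun h => hij (Subtype.ext h)) le_rfl

theorem not_cellularIn_souslinNumber : ¬ CellularIn T Set.univ (souslinNumber T) := by
  rw [cellularIn_univ_iff]
  refine csInf_mem (s := {c : Cardinal.{u} | ¬ ∃ 𝒞 : Set (Set X), IsCellular T 𝒞 ∧ #𝒞 = c})
    ⟨Order.succ #(Set X), ?_⟩
  rintro ⟨𝒞, -, h⟩
  exact absurd (mk_set_le 𝒞) (by rw [h]; exact not_le.2 (Order.lt_succ _))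

theorem lt_souslinNumber_iff {c : Cardinal.{u}} :
    c < souslinNumber T ↔ CellularIn T Set.univ c := by
  constructor
  · intro h
    rw [cellularIn_univ_iff]
    by_contra hn
    exact absurd (csInf_le' (s := {c : Cardinal.{u} | ¬ ∃ 𝒞 : Set (Set X), IsCellular T 𝒞 ∧ #𝒞 = c})
      hn) (not_le.2 h)
  · intro h
    by_contra! hn
    exact not_cellularIn_souslinNumber (h.mono hn)

/-- Among nonempty open sets `𝒢` whose union is dense, some member carries a cellular family of
any given regular size exceeding `#𝒢`, as soon as the whole space does. -/
theorem CellularIn.exists_mem {𝒢 : Set (Set X)} (hopen : ∀ V ∈ 𝒢, IsOpen[T] V)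
    (hmeet : ∀ W, IsOpen[T] W → W.Nonempty → ∃ V ∈ 𝒢, (W ∩ V).Nonempty)
    {c : Cardinal.{u}} (hc : c.IsRegular) (h𝒢 : #𝒢 < c) (h : CellularIn T Set.univ c) :
    ∃ V ∈ 𝒢, CellularIn T V c := by
  obtain ⟨f, hf, hd⟩ := h
  choose v hv hfv using fun i => hmeet (f i) (hf i).1 (hf i).2.1
  obtain ⟨V, hV⟩ := infinite_pigeonhole_card (fun i => (⟨v i, hv i⟩ : 𝒢)) c (by rw [mk_out])
    hc.aleph0_le (by rwa [hc.cof_ord])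
  refine ⟨V, V.2, .of_family (fun i : ((fun i => (⟨v i, hv i⟩ : 𝒢)) ⁻¹' {V} : Set _) => f i ∩ V)
    (fun i => ⟨(hf i).1.inter (hopen V V.2), ?_, Set.inter_subset_right⟩) ?_ hV⟩
  · have : v i = V := congrArg Subtype.val i.2
    exact this ▸ hfv i
  · intro i j hij
    exact (hd fun h => hij (Subtype.ext h)).mono Set.inter_subset_left Set.inter_subset_left

/-- A limit cardinal is the supremum of `cof` many smaller cardinals. -/
theorem exists_cofinal_family {l : Cardinal.{u}} (hlim : ∀ c < l, Order.succ c < l) :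
    ∃ (ι : Type u) (g : ι → Cardinal.{u}), #ι = l.ord.cof ∧ (∀ i, g i < l) ∧
      ∀ c < l, ∃ i, c < g i := by
  obtain ⟨S, hS, hSc⟩ := Order.exists_cof_eq l.ord.ToType
  refine ⟨S, fun i => (Ordinal.typein (α := l.ord.ToType) (· < ·) i.1).card, by rw [hSc, Ordinal.cof_toType],
    fun i => lt_ord.1 (Ordinal.typein_lt_self _), fun c hc => ?_⟩
  have h : (Order.succ c).ord < Ordinal.type (α := l.ord.ToType) (· < ·) := by
    rw [Ordinal.type_toType, ord_lt_ord]; exact hlim c hc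
  obtain ⟨b, hb, hab⟩ := hS (Ordinal.enum (α := l.ord.ToType) (· < ·) ⟨_, h⟩)
  refine ⟨⟨b, hb⟩, Order.succ_le_iff.1 (ord_le.1 ?_)⟩
  rw [← Ordinal.typein_enum (α := l.ord.ToType) (· < ·) h]
  exact (Ordinal.typein_le_typein (α := l.ord.ToType) (· < ·)).2 (not_lt.2 hab)

/-- The Erdős–Tarski theorem: an infinite Souslin number is regular. -/
theorem isRegular_souslinNumber (h0 : ℵ₀ ≤ souslinNumber T) : (souslinNumber T).IsRegular := by
  refine IsRegular.of_not_isSingular h0 fun hsing => ?_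
  set l := souslinNumber T with hl
  have hlim : ∀ c < l, Order.succ c < l := fun c hc => hsing.isSuccLimit.succ_lt hc
  obtain ⟨ι, f, hι, hgl, hgc⟩ := exists_cofinal_family hlim
  have hιl : #ι < l := hι ▸ hsing.cof_ord_lt
  -- Cellular families of sizes cofinal in `l`, placed in disjoint sets, would combine into one of
  -- size `l`.
  have hfin : ∀ G : ι → Set X, Pairwise (Function.onFun Disjoint G) →
      (∀ i, CellularIn T (G i) (f i)) → False := by
    intro G hG hc
    have := CellularIn.sum hG (fun i => Set.subset_univ (G i)) hc
    refine not_cellularIn_souslinNumber (this.mono ?_)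
    by_contra! hlt
    obtain ⟨i, hi⟩ := hgc _ hlt
    exact absurd (le_sum f i) (not_le.2 hi)
  by_cases hrich : ∃ V, IsOpen[T] V ∧ CellularIn T V #ι ∧ ∀ W, IsOpen[T] W → W.Nonempty → W ⊆ V →
      ∀ c < l, CellularIn T W c
  · obtain ⟨V, -, hcell, hW⟩ := hrich
    obtain ⟨G, hG, hGd⟩ := hcell
    obtain ⟨e⟩ : Nonempty (ι ≃ (#ι).out) := Cardinal.eq.1 (mk_out _).symm
    exact hfin (fun i => G (e i)) (fun i j hij => hGd (e.injective.ne hij)) fun i =>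
      hW _ (hG _).1 (hG _).2.1 (hG _).2.2 _ (hgl i)
  · have hpoor : ∀ V, IsOpen[T] V → V.Nonempty →
        ∃ W ⊆ V, IsOpen[T] W ∧ W.Nonempty ∧ ∃ c < l, ¬ CellularIn T W c := by
      intro V hV hVne
      by_contra! hcon
      exact hrich ⟨V, hV, hcon V subset_rfl hV hVne _ hιl, fun W hW hWne hWV c hc =>
        hcon W hWV hW hWne c hc⟩
    -- Every nonempty open set now contains one omitting some size below `l`, so a maximal disjoint
    -- family of such sets has dense union.
    obtain ⟨𝒢, h𝒢, h𝒢d, h𝒢m⟩ := exists_maximal_pairwise (r := Disjoint) (fun _ _ h => h.symm)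
      {W : Set X | IsOpen[T] W ∧ W.Nonempty ∧ ∃ c < l, ¬ CellularIn T W c}
    have h𝒢l : #𝒢 < l := lt_souslinNumber_iff.2 <| .of_family (fun i : 𝒢 => i.1)
      (fun i => ⟨(h𝒢 i.2).1, (h𝒢 i.2).2.1, Set.subset_univ _⟩)
      (fun i j hij => h𝒢d i.2 j.2 fun h => hij (Subtype.ext h)) le_rfl
    have hmeet : ∀ W, IsOpen[T] W → W.Nonempty → ∃ V ∈ 𝒢, (W ∩ V).Nonempty := by
      intro W hW hWne
      obtain ⟨W', hW'W, hW'⟩ := hpoor W hW hWne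
      by_contra! hcon
      have hdis : ∀ V ∈ 𝒢, Disjoint W' V := fun V hV =>
        (Set.disjoint_iff_inter_eq_empty.2 (hcon V hV)).mono_left hW'W
      have := hdis W' (h𝒢m W' hW' hdis)
      exact hW'.2.1.ne_empty (by simpa using this)
    choose s hsl hs using fun i : 𝒢 => (h𝒢 i.2).2.2
    -- If fewer than `cof l` members carried `f i` disjoint open sets, their omitted sizes would be
    -- bounded below `l`. But some member carries the successor of any large enough `b < l`,
    -- exceeding its own bound.
    obtain ⟨h, hinj, hh⟩ := exists_injective_choice
      (fun i : ι => {V : 𝒢 | CellularIn T V.1 (f i)}) (fun i => by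
        by_contra! hlt
        have hsup : (⨆ V : {V : 𝒢 | CellularIn T V.1 (f i)}, s V.1) < l :=
          iSup_lt_of_lt_cof_ord (by rw [← hι]; exact hlt) fun V => hsl V.1
        set b := max (max (⨆ V : {V : 𝒢 | CellularIn T V.1 (f i)}, s V.1) #𝒢)
          (max ℵ₀ (f i)) with hb
        have hbl : b < l := max_lt (max_lt hsup h𝒢l)
          (max_lt (h0.lt_of_ne fun h => not_isSingular_aleph0 (h ▸ hsing)) (hgl i))
        have hb0 : ℵ₀ ≤ b := (le_max_left _ _).trans (le_max_right _ _)
        obtain ⟨V, hV, hVc⟩ := CellularIn.exists_mem (fun V hV => (h𝒢 hV).1) hmeet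
          (isRegular_succ hb0) (Order.lt_succ_of_le ((le_max_right _ _).trans (le_max_left _ _)))
          (lt_souslinNumber_iff.1 (hlim b hbl))
        have hVi : (⟨V, hV⟩ : 𝒢) ∈ {V : 𝒢 | CellularIn T V.1 (f i)} :=
          hVc.mono (((le_max_right _ _).trans (le_max_right _ _)).trans (Order.le_succ b))
        refine hs ⟨V, hV⟩ (hVc.mono ?_)
        refine ((le_ciSup (f := fun V : {V : 𝒢 | CellularIn T V.1 (f i)} => s V.1)
          (bddAbove_of_small) ⟨_, hVi⟩).trans ?_).trans (Order.le_succ b)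
        exact (le_max_left _ _).trans (le_max_left _ _))
    exact hfin (fun i => (h i).1) (fun i j hij => h𝒢d (h i).2 (h j).2 fun he =>
      hij (hinj (Subtype.ext he))) hh

theorem aleph0_lt_souslinNumber (hT : @T2Space X T) (hX : Infinite X) : ℵ₀ < souslinNumber T := by
  obtain ⟨U, hinf, hopen, hd⟩ := exists_seq_infinite_isOpen_pairwise_disjoint X
  exact lt_souslinNumber_iff.2 <| .of_family (fun i : ULift.{u} ℕ => U i.down)
    (fun i => ⟨hopen _, (hinf _).nonempty, Set.subset_univ _⟩)
    (fun i j hij => hd fun h => hij (ULift.ext _ _ h)) (by simp)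

end

/-! ### Clopen expansions -/

section
variable {X : Type u} {T : TopologicalSpace X} {ι : Type u} {C : ι → Set X}

/-- The Boolean combination of the sets `C i`, `i ∈ F`, with sign pattern `σ`. -/
def booleanCell (C : ι → Set X) (F : Finset ι) (σ : Set ι) : Set X :=
  {x | ∀ i ∈ F, (x ∈ C i ↔ i ∈ σ)}

open Classical in
/-- The expansion of `T` in which every `C i` is declared clopen. -/
@[reducible]
noncomputable def clopenExpansion (T : TopologicalSpace X) (C : ι → Set X) : TopologicalSpace X :=
  TopologicalSpace.induced (fun x => ((x, fun i => decide (x ∈ C i)) : X × (ι → Bool)))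
    inferInstance

theorem isOpen_clopenExpansion {V : Set X} (hV : IsOpen[T] V) : IsOpen[clopenExpansion T C] V :=
  isOpen_induced_iff.2 ⟨Prod.fst ⁻¹' V, hV.preimage continuous_fst, rfl⟩

theorem isOpen_booleanCell (F : Finset ι) (σ : Set ι) :
    IsOpen[clopenExpansion T C] (booleanCell C F σ) := by
  classical
  refine isOpen_induced_iff.2 ⟨Prod.snd ⁻¹' {f : ι → Bool | ∀ i ∈ F, f i = decide (i ∈ σ)},
    IsOpen.preimage continuous_snd ?_, ?_⟩
  · have : {f : ι → Bool | ∀ i ∈ F, f i = decide (i ∈ σ)} =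
        (F : Set ι).pi fun i => {decide (i ∈ σ)} := by
      ext f; simp [Set.mem_pi]
    rw [this]
    exact isOpen_set_pi F.finite_toSet fun _ _ => isOpen_discrete _
  · ext x
    simp [booleanCell]

theorem exists_booleanCell_subset {O : Set X} (hO : IsOpen[clopenExpansion T C] O) {x : X}
    (hx : x ∈ O) : ∃ (V : Set X) (F : Finset ι) (σ : Set ι), IsOpen[T] V ∧
      x ∈ V ∩ booleanCell C F σ ∧ V ∩ booleanCell C F σ ⊆ O := by
  classical
  obtain ⟨O', hO', rfl⟩ := isOpen_induced_iff.1 hO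
  obtain ⟨V, P, hV, hP, hxV, hxP, hsub⟩ := isOpen_prod_iff.1 hO' _ _ hx
  obtain ⟨F, u, hu, huP⟩ := isOpen_pi_iff.1 hP _ hxP
  refine ⟨V, F, {i | x ∈ C i}, hV, ⟨hxV, fun i _ => Iff.rfl⟩, fun y hy => hsub ⟨hy.1, huP ?_⟩⟩
  intro i hi
  have : decide (y ∈ C i) = decide (x ∈ C i) := decide_eq_decide.2 (hy.2 i hi)
  simp only [this]
  exact (hu i hi).2

theorem t35Space_clopenExpansion (hT : @T35Space X T) : @T35Space X (clopenExpansion T C) := by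
  classical
  let _ : TopologicalSpace (X × (ι → Bool)) := inferInstance
  exact @IsEmbedding.t35Space X (clopenExpansion T C) (X × (ι → Bool)) _ inferInstance
    (fun x => (x, fun i => decide (x ∈ C i)))
    (@IsEmbedding.mk _ _ (clopenExpansion T C) _ _ (@IsInducing.mk _ _ (clopenExpansion T C) _ _ rfl)
      fun x y h => congrArg Prod.fst h)

theorem booleanCell_inter {F F' : Finset ι} {σ σ' : Set ι}
    [DecidableEq ι] (h : ∀ i ∈ F, i ∈ F' → (i ∈ σ ↔ i ∈ σ')) :
    booleanCell C (F ∪ F') {i | i ∈ F ∧ i ∈ σ ∨ i ∈ F' ∧ i ∈ σ'} ⊆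
      booleanCell C F σ ∩ booleanCell C F' σ' := by
  intro x hx
  refine ⟨fun i hi => ?_, fun i hi => ?_⟩ <;>
  · have := hx i (by simp [hi])
    simp only [Set.mem_ofPred_eq] at this
    have := h i
    tauto

/-- Shrink a cellular family to basic sets `V i ∩ cell`. If `V i` meets `V j`, disjointness forces
opposite signs at a common coordinate, since otherwise the merged cell would meet `V i ∩ V j`. The
combinatorial lemma then makes `S(X)` of the `V i` disjoint. -/
theorem souslinNumber_clopenExpansion (hreg : (souslinNumber T).IsRegular)
    (h0 : ℵ₀ < souslinNumber T)
    (hC : ∀ V F σ, IsOpen[T] V → V.Nonempty → (V ∩ booleanCell C F σ).Nonempty) :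
    souslinNumber (clopenExpansion T C) = souslinNumber T := by
  classical
  refine le_antisymm ?_ ?_
  · by_contra! hlt
    obtain ⟨f, hf, hd⟩ := lt_souslinNumber_iff.1 hlt
    choose x hx using fun i => (hf i).2.1
    choose V F σ hV hxV hVf using fun i => exists_booleanCell_subset (hf i).1 (hx i)
    obtain ⟨t, ht, htd⟩ := exists_pairwise_subfamily hreg h0
      (fun i j => Disjoint (V i) (V j)) F σ (by rw [mk_out]) (by
        intro i j hij
        by_contra! hcon
        obtain ⟨h1, h2⟩ := hcon
        obtain ⟨y, hy, hy'⟩ := hC (V i ∩ V j) (F i ∪ F j)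
          {k | k ∈ F i ∧ k ∈ σ i ∨ k ∈ F j ∧ k ∈ σ j} ((hV i).inter (hV j))
          (Set.not_disjoint_iff_nonempty_inter.1 h1)
        have := booleanCell_inter (fun k hk hk' => by simpa using h2 k hk hk') hy'
        exact Set.disjoint_left.1 (hd hij) (hVf i ⟨hy.1, this.1⟩) (hVf j ⟨hy.2, this.2⟩))
    exact not_cellularIn_souslinNumber <| .of_family (fun i : t => V i)
      (fun i => ⟨hV i, ⟨x i, (hxV i).1⟩, Set.subset_univ _⟩)
      (fun i j hij => htd i.2 j.2 fun h => hij (Subtype.ext h)) ht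
  · by_contra! hlt
    obtain ⟨f, hf, hd⟩ := lt_souslinNumber_iff.1 hlt
    exact not_cellularIn_souslinNumber (T := clopenExpansion T C)
      ⟨f, fun i => ⟨isOpen_clopenExpansion (hf i).1, (hf i).2⟩, hd⟩

/-- Each `D n` meets every `V ∩ booleanCell C F σ`, with `V` open and nonempty, in at least `c`
points. -/
def LargeOnCells (T : TopologicalSpace X) (D : ℕ → Set X) (C : ι → Set X) (c : Cardinal.{u}) :
    Prop :=
  ∀ n V F σ, IsOpen[T] V → V.Nonempty → c ≤ #↥(D n ∩ (V ∩ booleanCell C F σ))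

theorem LargeOnCells.le_of_isOpen {D : ℕ → Set X} {c : Cardinal.{u}} (h : LargeOnCells T D C c)
    (n : ℕ) {O : Set X} (hO : IsOpen[clopenExpansion T C] O) (hne : O.Nonempty) :
    c ≤ #↥(D n ∩ O) := by
  obtain ⟨x, hx⟩ := hne
  obtain ⟨V, F, σ, hV, hxV, hVO⟩ := exists_booleanCell_subset hO hx
  exact (h n V F σ hV ⟨x, hxV.1⟩).trans
    (mk_le_mk_of_subset (Set.inter_subset_inter_right _ hVO))

/-! ### Trimming and the bound on resolvability -/

/-- Remove from `B E` the points of `E`, for each `E ∈ A`. -/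
def trim (B : Set X → Set X) (A : Set (Set X)) (E : Set X) : Set X :=
  {x ∈ B E | E ∈ A → x ∉ E}

theorem exists_largeOnCells_of_dense {D : ℕ → Set X} {B : Set X → Set X} {c : Cardinal.{u}}
    (hc : c ≠ 0) (hX : Nonempty X) (hB : LargeOnCells T D B c) :
    ∃ C : Set X → Set X, LargeOnCells T D C c ∧ ∀ E, @Dense X (clopenExpansion T C) E →
      ∃ n O, IsOpen[clopenExpansion T C] O ∧ O.Nonempty ∧ #↥((D n ∩ O) \ E) < c := by
  obtain ⟨A, -, hA, hmax⟩ := zorn_subset_nonempty {A | LargeOnCells T D (trim B A) c} (by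
    intro 𝒜 h𝒜 hchain hne
    refine ⟨⋃₀ 𝒜, ?_, fun s hs => Set.subset_sUnion_of_mem hs⟩
    intro n V F σ hV hVne
    -- A cell involves finitely many indices, so one member of the chain already decides it.
    obtain ⟨A, hA, hFA⟩ := hchain.directedOn.exists_mem_subset_of_finite_of_subset_sUnion hne
      (F.finite_toSet.inter_of_left (⋃₀ 𝒜)) Set.inter_subset_right
    convert h𝒜 hA n V F σ hV hVne using 5
    ext x
    refine forall₂_congr fun E hE => ?_
    have : E ∈ ⋃₀ 𝒜 ↔ E ∈ A := ⟨fun h => hFA ⟨hE, h⟩, fun h => ⟨A, hA, h⟩⟩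
    simp only [trim, Set.mem_ofPred_eq, this]) ∅ (by
    have : trim B ∅ = B := by ext; simp [trim]
    simpa [this] using hB)
  refine ⟨trim B A, hA, fun E hE => ?_⟩
  by_cases hEA : E ∈ A
  · exfalso
    have hne : (booleanCell (trim B A) {E} {E}).Nonempty := by
      have := hc.bot_lt.trans_le (hA 0 Set.univ {E} {E} isOpen_univ Set.univ_nonempty)
      obtain ⟨x, hx⟩ := mk_ne_zero_iff.1 this.ne'
      exact ⟨x, hx.2.2⟩
    obtain ⟨x, hx, hxE⟩ := (@dense_iff_inter_open _ (clopenExpansion T (trim B A)) _).1 hE _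
      (isOpen_booleanCell _ _) hne
    exact ((hx E (by simp)).2 rfl).2 hEA hxE
  · have hnot : ¬ LargeOnCells T D (trim B (insert E A)) c := fun h =>
      hEA (hmax h (Set.subset_insert E A) (Set.mem_insert E A))
    unfold LargeOnCells at hnot
    push Not at hnot
    obtain ⟨n, V, F, σ, hV, hVne, hlt⟩ := hnot
    refine ⟨n, V ∩ booleanCell (trim B A) F σ,
      (clopenExpansion T (trim B A)).isOpen_inter _ _ (isOpen_clopenExpansion hV)
        (isOpen_booleanCell F σ), ?_,
      (mk_le_mk_of_subset ?_).trans_lt hlt⟩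
    · have := hc.bot_lt.trans_le (hA n V F σ hV hVne)
      obtain ⟨x, hx⟩ := mk_ne_zero_iff.1 this.ne'
      exact ⟨x, hx.2⟩
    -- Off `E`, trimming by `E` leaves every cell unchanged.
    · rintro x ⟨⟨hxD, hxV, hx⟩, hxE⟩
      refine ⟨hxD, hxV, fun E' hE' => ?_⟩
      rw [← hx E' hE']
      simp only [trim, Set.mem_ofPred_eq, Set.mem_insert_iff]
      refine and_congr_right fun _ => ⟨fun h hE'A => h (Or.inr hE'A), ?_⟩
      rintro h (rfl | h')
      exacts [hxE, h h']

/-- If `O E` and `O E'` met for the same `n`, the `c` or more points of `D n` in the intersection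
would be covered by two sets of size below `c`, as `E` and `E'` are disjoint. -/
theorem not_isResolvable_souslinNumber {D : ℕ → Set X} {c : Cardinal.{u}} (hc : ℵ₀ ≤ c)
    (hreg : (souslinNumber (clopenExpansion T C)).IsRegular)
    (h0 : ℵ₀ < souslinNumber (clopenExpansion T C)) (hD : LargeOnCells T D C c)
    (hE : ∀ E, @Dense X (clopenExpansion T C) E →
      ∃ n O, IsOpen[clopenExpansion T C] O ∧ O.Nonempty ∧ #↥((D n ∩ O) \ E) < c) :
    ¬ IsResolvable (clopenExpansion T C) (souslinNumber (clopenExpansion T C)) := by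
  rintro ⟨𝒟, hcard, hdense, hdis⟩
  choose n O hO hOne hlt using fun E : 𝒟 => hE E (hdense E E.2)
  obtain ⟨m, hm⟩ := infinite_pigeonhole_card (fun E => ULift.up.{u} (n E))
    (souslinNumber (clopenExpansion T C)) hcard.ge hreg.aleph0_le
    (by rw [hreg.cof_ord]; simpa using h0)
  refine not_cellularIn_souslinNumber (T := clopenExpansion T C) <| .of_family
    (fun E : ((fun E => ULift.up.{u} (n E)) ⁻¹' {m} : Set 𝒟) => O E)
    (fun E => ⟨hO _, hOne _, Set.subset_univ _⟩) (fun E E' hne => ?_) hm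
  have hn : n E.1 = m.down := congrArg ULift.down E.2
  have hn' : n E'.1 = m.down := congrArg ULift.down E'.2
  by_contra hnd
  have hle := hD.le_of_isOpen m.down ((clopenExpansion T C).isOpen_inter _ _ (hO E) (hO E'))
    (Set.not_disjoint_iff_nonempty_inter.1 hnd)
  refine absurd (hle.trans (mk_le_mk_of_subset (?_ : _ ⊆
    ((D (n E.1) ∩ O E) \ E.1.1) ∪ ((D (n E'.1) ∩ O E') \ E'.1.1)))) (not_le.2 ?_)
  · rintro x ⟨hxD, hx, hx'⟩
    by_cases hxE : x ∈ E.1.1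
    · refine Or.inr ⟨⟨hn' ▸ hxD, hx'⟩, fun hxE' => ?_⟩
      exact Set.disjoint_left.1 (hdis E.1.2 E'.1.2 fun h => hne (Subtype.ext (Subtype.ext h)))
        hxE hxE'
    · exact Or.inl ⟨⟨hn ▸ hxD, hx⟩, hxE⟩
  · exact (mk_union_le _ _).trans_lt (add_lt_of_lt hc (hlt _) (hlt _))

/-! ### Hausdorff's independent family -/

theorem IsResolvable.mono {c d : Cardinal.{u}} (h : IsResolvable T c) (hd : d ≤ c) :
    IsResolvable T d := by
  obtain ⟨𝒟, rfl, hdense, hdis⟩ := h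
  obtain ⟨ℰ, hsub, hcard⟩ := le_mk_iff_exists_subset.1 hd
  exact ⟨ℰ, hcard, fun E hE => hdense E (hsub hE), hdis.subset hsub⟩

theorem IsResolvable.exists_dense_fibers {β : Type u} [Nonempty β] (h : IsResolvable T #β) :
    ∃ g : X → β, ∀ b V, IsOpen[T] V → V.Nonempty → ∃ x ∈ V, g x = b := by
  classical
  obtain ⟨𝒟, hcard, hdense, hdis⟩ := h
  obtain ⟨e⟩ := Cardinal.eq.1 hcard
  refine ⟨fun x => if hx : ∃ E : 𝒟, x ∈ E.1 then e hx.choose else Classical.arbitrary β,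
    fun b V hV hVne => ?_⟩
  obtain ⟨x, hxV, hx⟩ := dense_iff_inter_open.1 (hdense _ (e.symm b).2) V hV hVne
  have hex : ∃ E : 𝒟, x ∈ E.1 := ⟨_, hx⟩
  refine ⟨x, hxV, ?_⟩
  have : hex.choose = e.symm b := by
    by_contra hne
    exact Set.disjoint_left.1 (hdis hex.choose.2 (e.symm b).2 fun h => hne (Subtype.ext h))
      hex.choose_spec hx
  simp only [dif_pos hex, this, Equiv.apply_symm_apply]

/-- Finitely many sets can be told apart by their traces on a finite set. -/
theorem exists_finset_separating [Nonempty X] (F : Finset (Set X)) :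
    ∃ K : Finset X, ∀ E ∈ F, ∀ E' ∈ F, (∀ x ∈ K, x ∈ E ↔ x ∈ E') → E = E' := by
  classical
  have : ∀ p : Set X × Set X, ∃ x, (x ∈ p.1 ↔ x ∈ p.2) → p.1 = p.2 := by
    intro p
    by_cases h : p.1 = p.2
    · exact ⟨Classical.arbitrary X, fun _ => h⟩
    · by_contra! hcon
      exact h (Set.ext fun x => (hcon x).1)
  choose d hd using this
  refine ⟨(F ×ˢ F).image d, fun E hE E' hE' h => hd (E, E') (h _ ?_)⟩
  exact Finset.mem_image_of_mem d (Finset.mk_mem_product hE hE')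

/-- A `#X`-resolvable infinite space carries countably many disjoint dense sets together
with an independent family indexed by the power set (after Hausdorff). -/
theorem exists_largeOnCells [Infinite X] (h : IsResolvable T #X) :
    ∃ (D : ℕ → Set X) (B : Set X → Set X), Pairwise (Function.onFun Disjoint D) ∧
      LargeOnCells T D B #X := by
  classical
  -- A label holds the index of `D n`, a free point providing `#X` witnesses, a finite `K`, and a
  -- finite family of finite sets; `B E` asks that the trace of `E` on `K` belong to this family.
  have hcard : #(ULift.{u} ℕ × X × Finset X × Finset (Finset X)) = #X := by
    have := aleph0_le_mk X
    simp [this, mul_eq_self, aleph0_mul_eq]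
  obtain ⟨g, hg⟩ := IsResolvable.exists_dense_fibers (hcard ▸ h)
  refine ⟨fun n => {x | (g x).1.down = n},
    fun E => {x | (g x).2.2.1.filter (· ∈ E) ∈ (g x).2.2.2}, ?_, ?_⟩
  · intro m n hmn
    exact Set.disjoint_left.2 fun x hm hn => hmn (hm.symm.trans hn)
  · intro n V F σ hV hVne
    obtain ⟨K, hK⟩ := exists_finset_separating F
    choose p hpV hp using fun y : X => hg (ULift.up n, y, K,
      (F.filter (· ∈ σ)).image fun E => K.filter (· ∈ E)) V hV hVne
    have hpm : ∀ y, p y ∈ {x | (g x).1.down = n} ∩ (V ∩ booleanCell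
        (fun E => {x | (g x).2.2.1.filter (· ∈ E) ∈ (g x).2.2.2}) F σ) := by
      intro y
      refine ⟨by simp [hp], hpV y, fun E hE => ?_⟩
      simp only [Set.mem_ofPred_eq, hp, Finset.mem_image, Finset.mem_filter]
      constructor
      · rintro ⟨E', ⟨hE', hσ⟩, heq⟩
        rwa [← hK E' hE' E hE fun x hx => by simpa [hx] using Finset.ext_iff.1 heq x]
      · exact fun hσ => ⟨E, ⟨hE, hσ⟩, rfl⟩
    refine mk_le_of_injective (f := fun y => ⟨p y, hpm y⟩) fun y z hyz => ?_
    have := congrArg g (congrArg Subtype.val hyz)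
    simp only [hp, Prod.mk.injEq] at this
    exact this.2.1

theorem LargeOnCells.isResolvable_aleph0 {D : ℕ → Set X} {c : Cardinal.{u}} (hc : c ≠ 0)
    (hX : Nonempty X) (h : LargeOnCells T D C c) (hd : Pairwise (Function.onFun Disjoint D)) :
    IsResolvable (clopenExpansion T C) ℵ₀ := by
  have hne : ∀ n {O : Set X}, IsOpen[clopenExpansion T C] O → O.Nonempty → (D n ∩ O).Nonempty := by
    intro n O hO hOne
    obtain ⟨x, hx⟩ := mk_ne_zero_iff.1 (hc.bot_lt.trans_le (h.le_of_isOpen n hO hOne)).ne'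
    exact ⟨x, hx⟩
  have hinj : Function.Injective D := by
    intro m n hmn
    by_contra hne'
    obtain ⟨x, hx, -⟩ := hne m (@isOpen_univ _ (clopenExpansion T C)) Set.univ_nonempty
    exact Set.disjoint_left.1 (hd hne') hx (hmn ▸ hx)
  refine ⟨Set.range D, ?_, ?_, ?_⟩
  · have := (Set.countable_range D).to_subtype
    have := Infinite.of_injective _ (Set.rangeFactorization_injective.2 hinj)
    exact mk_eq_aleph0 _
  · rintro _ ⟨n, rfl⟩
    refine (@dense_iff_inter_open _ (clopenExpansion T C) _).2 fun O hO hOne => ?_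
    rw [Set.inter_comm]
    exact hne n hO hOne
  · rintro _ ⟨m, rfl⟩ _ ⟨n, rfl⟩ hmn
    exact hd fun h => hmn (congrArg D h)

theorem infinite_of_isCrowded (hT : @T35Space X T) (hcrowded : IsCrowded T)
    (hS : souslinNumber T ≤ #X) : Infinite X := by
  rcases isEmpty_or_nonempty X with hX | ⟨⟨x⟩⟩
  · have : (0 : Cardinal.{u}) < souslinNumber T := lt_souslinNumber_iff.2 <|
      .of_family (ι := PEmpty.{u + 1}) (fun i => i.elim) (fun i => i.elim) (fun i => i.elim)
        zero_le
    exact absurd (this.trans_le hS) (by simp)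
  · by_contra hfin
    have : Finite X := not_infinite_iff_finite.1 hfin
    exact hcrowded x (isOpen_discrete _)

end

/-! ### The main theorem -/

theorem theorem3p1 {X : Type u} (T : TopologicalSpace X) (κ : Cardinal.{u})
    (hTych : @T35Space X T) (hcrowded : IsCrowded T) (hres : IsResolvable T ℵ₀)
    (hS : souslinNumber T ≤ #X) (hX : #X = κ) (hΔ : dispersionCharacter T = κ) :
    ∃ U : TopologicalSpace X,
      (∀ V : Set X, IsOpen[T] V → IsOpen[U] V) ∧
      @T35Space X U ∧
      souslinNumber U = souslinNumber T ∧
      dispersionCharacter U = dispersionCharacter T ∧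
      IsResolvable U ℵ₀ ∧
      ¬ IsMaximallyResolvable U ∧
      (IsMaximallyResolvable T → ¬ IsResolvable U (souslinNumber T)) := by
  by_cases hmax : IsMaximallyResolvable T
  swap
  · exact ⟨T, fun _ h => h, hTych, rfl, rfl, hres, hmax, fun h => absurd h hmax⟩
  subst hX
  have hinf : Infinite X := infinite_of_isCrowded hTych hcrowded hS
  have h0 : ℵ₀ < souslinNumber T := aleph0_lt_souslinNumber inferInstance hinf
  have hreg := isRegular_souslinNumber h0.le
  have hX0 : #X ≠ 0 := mk_ne_zero X
  obtain ⟨D, B, hd, hB⟩ := exists_largeOnCells (hΔ ▸ hmax : IsResolvable T #X)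
  obtain ⟨C, hC, hE⟩ := exists_largeOnCells_of_dense hX0 inferInstance hB
  have hSU : souslinNumber (clopenExpansion T C) = souslinNumber T := by
    refine souslinNumber_clopenExpansion hreg h0 fun V F σ hV hVne => ?_
    obtain ⟨x, hx⟩ := mk_ne_zero_iff.1 (hX0.bot_lt.trans_le (hC 0 V F σ hV hVne)).ne'
    exact ⟨x, hx.2⟩
  have hΔU : dispersionCharacter (clopenExpansion T C) = #X := by
    refine le_antisymm (csInf_le' ⟨Set.univ, @isOpen_univ _ (clopenExpansion T C),
      Set.univ_nonempty, mk_univ⟩) (le_csInf ⟨_, Set.univ, @isOpen_univ _ (clopenExpansion T C),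
      Set.univ_nonempty, rfl⟩ ?_)
    rintro _ ⟨V, hV, hVne, rfl⟩
    exact (hC.le_of_isOpen 0 hV hVne).trans (mk_le_mk_of_subset Set.inter_subset_right)
  have hnot : ¬ IsResolvable (clopenExpansion T C) (souslinNumber T) := by
    have := not_isResolvable_souslinNumber (aleph0_le_mk X) (hSU ▸ hreg) (hSU ▸ h0) hC hE
    rwa [hSU] at this
  refine ⟨clopenExpansion T C, fun V => isOpen_clopenExpansion, t35Space_clopenExpansion hTych,
    hSU, hΔU.trans hΔ.symm, hC.isResolvable_aleph0 hX0 inferInstance hd, fun h => hnot ?_,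
    fun _ => hnot⟩
  exact IsResolvable.mono (hΔU ▸ h) hS
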